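/- Let $p$ be a prime and let $s,m,n$ be positive integers. A family $\alpha_1,\dots,\alpha_k$ of vectors in $\mathbb{Z}_{p^s}^n$ (where $\mathbb{Z}_{p^s}=\mathbb{Z}/p^s\mathbb{Z}$) is called unimodular if the $k\times n$ matrix with rows $\alpha_1,\dots,\alpha_k$ has a right inverse. The dimension of a $\mathbb{Z}_{p^s}$-submodule $V\subseteq\mathbb{Z}_{p^s}^n$ is the largest number of vectors in a unimodular family of vectors of $V$, and a $k$-subspace of $\mathbb{Z}_{p^s}^n$ is a submodule having a unimodular basis with $k$ elements (the $0$-subspace being $\{0\}$). For $1\le m<n$, the Grassmann graph $G_{p^s}(n,m)$ has as vertices all $m$-subspaces of $\mathbb{Z}_{p^s}^n$, two of them being adjacent if their intersection is a submodule of dimension $m-1$. A star is the set of all $m$-subspaces containing a fixed $(m-1)$-subspace of $\mathbb{Z}_{p^s}^n$, and a top is the set of all $m$-subspaces contained in a fixed $(m+1)$-subspace of $\mathbb{Z}_{p^s}^n$. A maximum clique is a clique of largest cardinality. **Theorem.** When $n>2m$, every maximum clique of $G_{p^s}(n,m)$ is a star. When $n=2m$, every maximum clique of $G_{p^s}(n,m)$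 is a star or a top. -/

import Mathlib

namespace ResidueGrassmann

/-- A finite family of vectors of `R ^ n` is unimodular if the matrix having these vectors as rows
has a right inverse. -/
def IsUnimodular {R : Type*} [CommRing R] {n k : ℕ} (v : Fin k → Fin n → R) : Prop :=
  ∃ B : Matrix (Fin n) (Fin k) R, Matrix.of v * B = 1

/-- The sizes of the unimodular families of vectors lying in a linear subset `V` of `R ^ n`. -/
def unimodularSizes {R : Type*} [CommRing R] {n : ℕ} (V : Submodule R (Fin n → R)) : Set ℕ :=
  {k | ∃ v : Fin k → Fin n → R, (∀ i, v i ∈ V) ∧ IsUnimodular v}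

/-- The dimension of a linear subset `V` of `R ^ n`: the number of vectors in a largest unimodular
vector set of `V`. For a nontrivial ring it is attained, see `dim_isGreatest`. -/
noncomputable def dim {R : Type*} [CommRing R] {n : ℕ} (V : Submodule R (Fin n → R)) : ℕ :=
  sSup (unimodularSizes V)

/-- A unimodular family of vectors of `R ^ n` is linearly independent. -/
theorem IsUnimodular.linearIndependent {R : Type*} [CommRing R] {n k : ℕ} {v : Fin k → Fin n → R}
    (hv : IsUnimodular v) : LinearIndependent R v := by
  obtain ⟨B, hB⟩ := hv
  have h : Function.Injective (Matrix.of v).vecMul := by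
    intro x y hxy
    have h2 := congrArg (fun z => Matrix.vecMul z B) hxy
    simpa [Matrix.vecMul_vecMul, hB] using h2
  exact Matrix.vecMul_injective_iff.mp h

/-- Over a nontrivial ring the dimension is the size of an actual largest unimodular family. -/
theorem dim_isGreatest {R : Type*} [CommRing R] [Nontrivial R] {n : ℕ}
    (V : Submodule R (Fin n → R)) : IsGreatest (unimodularSizes V) (dim V) := by
  have hb : BddAbove (unimodularSizes V) := by
    refine ⟨n, ?_⟩
    rintro k ⟨v, -, hv⟩
    simpa using hv.linearIndependent.fintype_card_le_finrank
  have h0 : (unimodularSizes V).Nonempty :=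
    ⟨0, fun i => i.elim0, fun i => i.elim0, 0, Subsingleton.elim _ _⟩
  exact ⟨Nat.sSup_mem h0 hb, fun k hk => le_csSup hb hk⟩

/-- A linear subset `X` of `R ^ n` is a `k`-subspace if it has a unimodular basis with `k`
elements. -/
def IsSubspace {R : Type*} [CommRing R] {n : ℕ} (k : ℕ) (X : Submodule R (Fin n → R)) : Prop :=
  ∃ v : Fin k → Fin n → R,
    IsUnimodular v ∧ LinearIndependent R v ∧ Submodule.span R (Set.range v) = X

/-- The set of all `m`-subspaces of `R ^ n`, as a type. -/
abbrev Vertex (R : Type*) [CommRing R] (n m : ℕ) : Type _ :=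
  {X : Submodule R (Fin n → R) // IsSubspace m X}

/-- The Grassmann graph over `R`, for `1 ≤ m`: its vertices are the `m`-subspaces of `R ^ n`, and
two (distinct) vertices are adjacent if their intersection is a linear subset of dimension
`m - 1`. -/
def grassmannGraph (R : Type*) [CommRing R] (n m : ℕ) : SimpleGraph (Vertex R n m) where
  Adj X Y := X ≠ Y ∧ dim (X.1 ⊓ Y.1) = m - 1
  symm := ⟨fun X Y h => ⟨h.1.symm, by rw [inf_comm]; exact h.2⟩⟩
  loopless := ⟨fun _ h => h.1 rfl⟩

/-- A star, for `1 ≤ m`: the set of all `m`-subspaces containing a fixed `(m - 1)`-subspace. -/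
def IsStar {R : Type*} [CommRing R] {n m : ℕ} (S : Set (Vertex R n m)) : Prop :=
  ∃ P : Submodule R (Fin n → R), IsSubspace (m - 1) P ∧ S = {X | P ≤ X.1}

/-- A top: the set of all `m`-subspaces contained in a fixed `(m + 1)`-subspace. -/
def IsTop {R : Type*} [CommRing R] {n m : ℕ} (S : Set (Vertex R n m)) : Prop :=
  ∃ Q : Submodule R (Fin n → R), IsSubspace (m + 1) Q ∧ S = {X | X.1 ≤ Q}

end ResidueGrassmann

/-! Write R for the ring, I for its maximal ideal, q for the size of the residue field and m = l +
1, with n ≥ 2m. Submodules are compared modulo I, that is, after adding `residueKer`. Adjacency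
means being distinct with a common l-subspace. Some star contains a clique of size |R|^(n-m), so a
maximum clique is at least that large.

If all members agree modulo I, they are given by m × (n-m) matrices over I, the rows of two of them
differing by multiples u_i b of a single vector. As m ≤ n-m, multiplication in a degree n-m
extension of the residue field, lifted to R, yields matrices T_i for which A ↦ ∑ T_i A_i separates
them. So there are at most |I|^(n-m) members, too few (`card_clique_le_of_le_sup_residueKer`).

Otherwise two members X, Z differ modulo I, and the argument known over fields survives
(`clique_trichotomy`): all members contain X ⊓ Z, or all lie in X ⊔ Z, or modulo I all lie between
the two. The first case gives a star. In the second there are fewer than |R|^(m+1) members, which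
forces n = 2m, and a top is a clique because divisibility in ℤ/p^s is total. In the third there are
at most q² - 1 residue classes of at most |I|^(n-m) members each, again too few, since |R| = q|I|
and n-m ≥ 2 for m ≥ 2. For m = 1 the full vertex set is a star. -/

namespace ResidueGrassmann

/-! ### Unimodular families and dual maps -/

section CommRing

variable {R : Type*} [CommRing R] {n k : ℕ}

/-- A family is unimodular exactly when some linear map sends it to the standard basis. -/
theorem isUnimodular_iff_exists_dual {v : Fin k → Fin n → R} :
    IsUnimodular v ↔
      ∃ β : (Fin n → R) →ₗ[R] (Fin k → R), ∀ i, β (v i) = Pi.single i 1 := by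
  constructor
  · rintro ⟨B, hB⟩
    refine ⟨Matrix.vecMulLinear B, fun i => ?_⟩
    ext j
    have h := congrFun (congrFun hB i) j
    rw [Matrix.one_apply] at h
    rw [Pi.single_apply]
    simpa [Matrix.mul_apply, Matrix.vecMul, dotProduct, eq_comm] using h
  · rintro ⟨β, hβ⟩
    refine ⟨Matrix.of fun i j => β (Pi.single i 1) j, ?_⟩
    ext i j
    have h := congrFun (hβ i) j
    rw [pi_eq_sum_univ' (v i)] at h
    simp only [map_sum, map_smul] at h
    rw [Matrix.one_apply, Matrix.mul_apply]
    rw [Pi.single_apply] at h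
    simpa [eq_comm] using h

theorem IsUnimodular.isSubspace_span {v : Fin k → Fin n → R} (hv : IsUnimodular v) :
    IsSubspace k (Submodule.span R (Set.range v)) :=
  ⟨v, hv, hv.linearIndependent, rfl⟩

theorem isSubspace_zero_bot : IsSubspace 0 (⊥ : Submodule R (Fin n → R)) := by
  refine ⟨fun i => i.elim0, ⟨0, Subsingleton.elim _ _⟩, linearIndependent_empty_type, ?_⟩
  simp

/-- A unimodular family of `k` vectors of a `k`-subspace spans it. -/
theorem IsSubspace.span_eq {X : Submodule R (Fin n → R)} (hX : IsSubspace k X)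
    {v : Fin k → Fin n → R} (hv : IsUnimodular v) (hvX : ∀ i, v i ∈ X) :
    Submodule.span R (Set.range v) = X := by
  obtain ⟨x, -, -, rfl⟩ := hX
  obtain ⟨β, hβ⟩ := isUnimodular_iff_exists_dual.1 hv
  refine le_antisymm (Submodule.span_le.2 (by rintro _ ⟨i, rfl⟩; exact hvX i)) ?_
  have h := fun i => (Submodule.mem_span_range_iff_exists_fun R).1 (hvX i)
  choose c hc using h
  have h1 : (Matrix.of c) * (Matrix.of fun i j => β (x i) j) = 1 := by
    ext i j
    have h2 := congrFun (hβ i) j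
    rw [← hc i] at h2
    rw [Matrix.one_apply, Matrix.mul_apply]
    rw [Pi.single_apply] at h2
    simpa [eq_comm] using h2
  -- Both matrices are k × k, so the one-sided inverse is two-sided and expresses the basis `x`
  -- through `v`.
  have h2 := mul_eq_one_comm.1 h1
  refine Submodule.span_le.2 ?_
  rintro _ ⟨i, rfl⟩
  have h3 : x i = ∑ j, β (x i) j • v j := by
    simp only [← hc, Finset.smul_sum, smul_smul]
    rw [Finset.sum_comm]
    simp only [← Finset.sum_smul]
    have h4 : ∀ j, ∑ l, β (x i) l * c l j = if i = j then 1 else 0 := by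
      intro j
      have := congrFun (congrFun h2 i) j
      rwa [Matrix.mul_apply, Matrix.one_apply] at this
    simp [h4]
  rw [h3]
  exact Submodule.sum_mem _ fun j _ => Submodule.smul_mem _ _ (Submodule.subset_span ⟨j, rfl⟩)

theorem IsSubspace.eq_of_le {X Y : Submodule R (Fin n → R)} (hX : IsSubspace k X)
    (hY : IsSubspace k Y) (h : X ≤ Y) : X = Y := by
  obtain ⟨v, hv, -, rfl⟩ := hX
  exact hY.span_eq hv fun i => h (Submodule.subset_span ⟨i, rfl⟩)

end CommRing

/-! ### Subspaces modulo the maximal ideal -/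

section LocalRing

variable {R : Type*} [CommRing R] [IsLocalRing R] {n k l m : ℕ}

open IsLocalRing

/-- The vectors all of whose coordinates lie in the maximal ideal. -/
def residueKer (R : Type*) [CommRing R] [IsLocalRing R] (n : ℕ) : Submodule R (Fin n → R) :=
  Submodule.pi Set.univ fun _ => maximalIdeal R

theorem mem_residueKer {x : Fin n → R} : x ∈ residueKer R n ↔ ∀ i, x i ∈ maximalIdeal R := by
  simp [residueKer, Submodule.mem_pi]

theorem smul_mem_residueKer {a : R} (ha : a ∈ maximalIdeal R) (x : Fin n → R) :
    a • x ∈ residueKer R n :=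
  mem_residueKer.2 fun i => Ideal.mul_mem_right (x i) _ ha

theorem map_mem_maximalIdeal (φ : (Fin n → R) →ₗ[R] R) {x : Fin n → R}
    (hx : x ∈ residueKer R n) : φ x ∈ maximalIdeal R := by
  rw [pi_eq_sum_univ' x, map_sum]
  refine Ideal.sum_mem _ fun i _ => ?_
  rw [map_smul]
  exact Ideal.mul_mem_right _ _ (mem_residueKer.1 hx i)

theorem map_mem_residueKer (φ : (Fin n → R) →ₗ[R] (Fin k → R)) {x : Fin n → R}
    (hx : x ∈ residueKer R n) : φ x ∈ residueKer R k :=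
  mem_residueKer.2 fun i => map_mem_maximalIdeal (LinearMap.proj i ∘ₗ φ) hx

/-- A vector outside a subspace modulo the maximal ideal is detected by a functional. -/
theorem IsSubspace.exists_functional {P : Submodule R (Fin n → R)} (hP : IsSubspace k P)
    {a : Fin n → R} (ha : a ∉ P ⊔ residueKer R n) :
    ∃ φ : (Fin n → R) →ₗ[R] R, (∀ x ∈ P, φ x = 0) ∧ φ a = 1 := by
  obtain ⟨v, hv, -, rfl⟩ := hP
  obtain ⟨β, hβ⟩ := isUnimodular_iff_exists_dual.1 hv
  set σ : (Fin k → R) →ₗ[R] (Fin n → R) := Fintype.linearCombination R v with hσ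
  -- The projection with kernel P. A coordinate of `pr a` is a unit, and rescaling it gives `φ`.
  set pr : (Fin n → R) →ₗ[R] (Fin n → R) := LinearMap.id - σ ∘ₗ β with hpr
  have hprv : ∀ x ∈ Submodule.span R (Set.range v), pr x = 0 := by
    intro x hx
    have : Submodule.span R (Set.range v) ≤ LinearMap.ker pr := by
      refine Submodule.span_le.2 ?_
      rintro _ ⟨i, rfl⟩
      simp [hpr, hβ, hσ]
    exact this hx
  have h1 : pr a ∉ residueKer R n := by
    intro h
    apply ha
    have h2 : a = σ (β a) + pr a := by simp [hpr]
    rw [h2]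
    refine Submodule.add_mem_sup ?_ h
    rw [hσ, Fintype.linearCombination_apply]
    exact Submodule.sum_mem _ fun j _ => Submodule.smul_mem _ _ (Submodule.subset_span ⟨j, rfl⟩)
  rw [mem_residueKer] at h1
  push Not at h1
  obtain ⟨i, hi⟩ := h1
  rw [mem_maximalIdeal, mem_nonunits_iff, not_not] at hi
  obtain ⟨u, hu⟩ := hi
  refine ⟨(↑u⁻¹ : R) • (LinearMap.proj i ∘ₗ pr), fun x hx => ?_, ?_⟩
  · simp [hprv x hx]
  · simp [← hu]

/-- Adding a vector that is new modulo the maximal ideal. -/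
theorem IsSubspace.sup_span {P : Submodule R (Fin n → R)} (hP : IsSubspace k P)
    {a : Fin n → R} (ha : a ∉ P ⊔ residueKer R n) : IsSubspace (k + 1) (P ⊔ R ∙ a) := by
  obtain ⟨φ, hφ, hφa⟩ := hP.exists_functional ha
  obtain ⟨v, hv, -, rfl⟩ := hP
  obtain ⟨β, hβ⟩ := isUnimodular_iff_exists_dual.1 hv
  have hφv : ∀ i, φ (v i) = 0 := fun i => hφ _ (Submodule.subset_span ⟨i, rfl⟩)
  have hu : IsUnimodular (Fin.cons a v : Fin (k + 1) → Fin n → R) := by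
    -- Subtracting `φ` times `β a` kills the old coordinates of `a` without changing `β` on the `v
    -- i`.
    refine isUnimodular_iff_exists_dual.2
      ⟨LinearMap.pi (Fin.cons φ fun i => LinearMap.proj i ∘ₗ (β - LinearMap.toSpanSingleton R _ (β a) ∘ₗ φ)),
        fun i => ?_⟩
    ext j
    refine Fin.cases ?_ (fun i => ?_) i <;> refine Fin.cases ?_ (fun j => ?_) j
    · simp [hφa]
    · simp [hφa]
    · simp [hφv]
    · simp [hφv, hβ, Pi.single_apply]
  have h2 : Submodule.span R (Set.range (Fin.cons a v : Fin (k + 1) → Fin n → R)) =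
      Submodule.span R (Set.range v) ⊔ R ∙ a := by
    rw [Fin.range_cons, Submodule.span_insert, sup_comm]
  rw [← h2]
  exact hu.isSubspace_span

/-- A subspace decomposes along any codimension one subspace. -/
theorem IsSubspace.eq_sup_span {P X : Submodule R (Fin n → R)} (hP : IsSubspace l P)
    (hX : IsSubspace (l + 1) X) (hPX : P ≤ X) {a : Fin n → R} (haX : a ∈ X)
    (ha : a ∉ P ⊔ residueKer R n) : X = P ⊔ R ∙ a :=
  ((hP.sup_span ha).eq_of_le hX (sup_le hPX (by simpa using haX))).symm

/-- Vectors close to a dual basis of `β` can be normalised to one, staying close. -/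
theorem exists_normalized (β : (Fin n → R) →ₗ[R] (Fin k → R)) {y : Fin k → Fin n → R}
    (hy : ∀ i, β (y i) - Pi.single i 1 ∈ residueKer R k) :
    ∃ z : Fin k → Fin n → R, (∀ i, z i ∈ Submodule.span R (Set.range y)) ∧
      (∀ i, β (z i) = Pi.single i 1) ∧ ∀ i, z i - y i ∈ residueKer R n := by
  -- `U` reduces to the identity, hence is invertible with inverse reducing to the identity:
  -- applying `U⁻¹` normalises `y` and moves it only within `residueKer`.
  set U : Matrix (Fin k) (Fin k) R := Matrix.of fun i j => β (y i) j with hU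
  have hU1 : U.map (residue R) = 1 := by
    ext i j
    have h := mem_residueKer.1 (hy i) j
    rw [← residue_eq_zero_iff, Pi.sub_apply, map_sub, sub_eq_zero] at h
    simp only [Matrix.map_apply, hU, Matrix.of_apply, h, Matrix.one_apply, Pi.single_apply]
    simp [eq_comm, apply_ite (residue R)]
  have hdet : IsUnit U.det := by
    rw [← residue_ne_zero_iff_isUnit, RingHom.map_det, RingHom.mapMatrix_apply, hU1]
    simp
  have hinv : U⁻¹ * U = 1 := Matrix.nonsing_inv_mul U hdet
  have hinv1 : (U⁻¹).map (residue R) = 1 := by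
    have := congrArg (fun A => A.map (residue R)) hinv
    simpa [Matrix.map_mul, hU1] using this
  refine ⟨fun i => ∑ j, U⁻¹ i j • y j, fun i => ?_, fun i => ?_, fun i => ?_⟩
  · exact Submodule.sum_mem _ fun j _ => Submodule.smul_mem _ _ (Submodule.subset_span ⟨j, rfl⟩)
  · ext j
    have h := congrFun (congrFun hinv i) j
    rw [Matrix.mul_apply, Matrix.one_apply] at h
    simpa [Pi.single_apply, hU, eq_comm] using h
  · have h : ∑ j, U⁻¹ i j • y j - y i = ∑ j, (U⁻¹ i j - (1 : Matrix _ _ R) i j) • y j := by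
      simp [sub_smul, Matrix.one_apply, Finset.sum_sub_distrib]
    rw [h]
    refine Submodule.sum_mem _ fun j _ => smul_mem_residueKer ?_ _
    have h2 := congrFun (congrFun hinv1 i) j
    rw [← residue_eq_zero_iff, map_sub, sub_eq_zero]
    rw [Matrix.map_apply] at h2
    rw [h2]
    simp [Matrix.one_apply, apply_ite (residue R)]

/-- A subspace that lies in `W` modulo the maximal ideal lifts to a subspace of `W`. -/
theorem IsSubspace.exists_lift {P W : Submodule R (Fin n → R)} (hP : IsSubspace k P)
    (h : P ≤ W ⊔ residueKer R n) :
    ∃ P', IsSubspace k P' ∧ P' ≤ W ∧ P' ≤ P ⊔ residueKer R n ∧ P ≤ P' ⊔ residueKer R n := by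
  obtain ⟨v, hv, -, rfl⟩ := hP
  obtain ⟨β, hβ⟩ := isUnimodular_iff_exists_dual.1 hv
  have h1 : ∀ i, ∃ y ∈ W, v i - y ∈ residueKer R n := by
    intro i
    obtain ⟨y, hy, j, hj, e⟩ := Submodule.mem_sup.1 (h (Submodule.subset_span ⟨i, rfl⟩))
    exact ⟨y, hy, by simpa [← e] using hj⟩
  choose y hyW hy using h1
  have hy' : ∀ i, y i - v i ∈ residueKer R n := fun i => by
    rw [← neg_sub]; exact neg_mem (hy i)
  obtain ⟨z, hz, hβz, hzy⟩ := exists_normalized β (y := y) fun i => by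
    rw [← hβ i, ← map_sub]
    exact map_mem_residueKer β (hy' i)
  have hzv : ∀ i, z i - v i ∈ residueKer R n := fun i => by
    simpa using add_mem (hzy i) (hy' i)
  refine ⟨_, (isUnimodular_iff_exists_dual.2 ⟨β, hβz⟩).isSubspace_span, ?_, ?_, ?_⟩
  · refine Submodule.span_le.2 ?_
    rintro _ ⟨i, rfl⟩
    have : Submodule.span R (Set.range y) ≤ W :=
      Submodule.span_le.2 (by rintro _ ⟨i, rfl⟩; exact hyW i)
    exact this (hz i)
  · refine Submodule.span_le.2 ?_
    rintro _ ⟨i, rfl⟩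
    have := Submodule.add_mem_sup
      (Submodule.subset_span (R := R) (Set.mem_range_self (f := v) i)) (hzv i)
    simpa using this
  · refine Submodule.span_le.2 ?_
    rintro _ ⟨i, rfl⟩
    have := Submodule.add_mem_sup
      (Submodule.subset_span (R := R) (Set.mem_range_self (f := z) i)) (neg_mem (hzv i))
    simpa using this

/-- A lift of Z into X is a k-subspace of X, hence all of X. Inclusion modulo the maximal ideal is
thus an equivalence between subspaces of equal dimension. -/
theorem IsSubspace.le_sup_residueKer_symm {X Z : Submodule R (Fin n → R)} (hX : IsSubspace k X)
    (hZ : IsSubspace k Z) (h : Z ≤ X ⊔ residueKer R n) : X ≤ Z ⊔ residueKer R n := by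
  obtain ⟨P, hP, hPX, h1, -⟩ := hZ.exists_lift h
  rwa [hP.eq_of_le hX hPX] at h1

/-- A subspace is not contained in a smaller one modulo the maximal ideal. -/
theorem IsSubspace.not_le_sup_residueKer {P X : Submodule R (Fin n → R)} (hP : IsSubspace l P)
    (hX : IsSubspace (l + 1) X) : ¬ X ≤ P ⊔ residueKer R n := by
  intro h
  obtain ⟨X', hX', hle, -, -⟩ := hX.exists_lift h
  obtain ⟨p, hp, -, rfl⟩ := hP
  obtain ⟨x, hx, -, rfl⟩ := hX'
  have h1 : ∀ i, x i ∈ Submodule.span R (Set.range p) :=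
    fun i => hle (Submodule.subset_span ⟨i, rfl⟩)
  have h3 : LinearIndependent R fun i => (⟨x i, h1 i⟩ : Submodule.span R (Set.range p)) :=
    LinearIndependent.of_comp (Submodule.subtype _) hx.linearIndependent
  have : Module.Finite R (Submodule.span R (Set.range p)) :=
    Module.Finite.span_of_finite R (Set.finite_range p)
  have h4 := h3.fintype_card_le_finrank
  rw [finrank_span_eq_card hp.linearIndependent] at h4
  simp at h4

end LocalRing

/-! ### Common subspaces -/

section Share

variable {R : Type*} [CommRing R] {n l : ℕ}

/-- Two submodules with a common `l`-subspace. -/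
def ShareSubspace (l : ℕ) (X Y : Submodule R (Fin n → R)) : Prop :=
  ∃ P, IsSubspace l P ∧ P ≤ X ∧ P ≤ Y

theorem ShareSubspace.symm {X Y : Submodule R (Fin n → R)} (h : ShareSubspace l X Y) :
    ShareSubspace l Y X :=
  let ⟨P, hP, h1, h2⟩ := h
  ⟨P, hP, h2, h1⟩

end Share

/-! ### Stars and tops modulo the maximal ideal -/

section Configurations

open IsLocalRing

variable {R : Type*} [CommRing R] [IsLocalRing R] {n k l m : ℕ}

/-- If `c` is new modulo `S`, then `P ⊔ R ∙ c` meets `S` only in `P`. -/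
theorem IsSubspace.inf_sup_span_le {S P : Submodule R (Fin n → R)} (hS : IsSubspace k S)
    (hPS : P ≤ S) {c : Fin n → R} (hc : c ∉ S ⊔ residueKer R n) : (P ⊔ R ∙ c) ⊓ S ≤ P := by
  obtain ⟨φ, hφ, hφc⟩ := hS.exists_functional hc
  rintro x ⟨hx, hxS⟩
  obtain ⟨y, hy, z, hz, rfl⟩ := Submodule.mem_sup.1 hx
  obtain ⟨γ, rfl⟩ := Submodule.mem_span_singleton.1 hz
  have h := hφ _ hxS
  rw [map_add, hφ y (hPS hy), map_smul, hφc] at h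
  have : γ = 0 := by simpa using h
  simpa [this] using hy

theorem not_mem_sup_residueKer_of_le {P S : Submodule R (Fin n → R)} (hPS : P ≤ S)
    {c : Fin n → R} (hc : c ∉ S ⊔ residueKer R n) : c ∉ P ⊔ residueKer R n :=
  fun h => hc (sup_le_sup_right hPS _ h)

theorem exists_not_mem_sup_residueKer {S W : Submodule R (Fin n → R)}
    (h : ¬ W ≤ S ⊔ residueKer R n) : ∃ c ∈ W, c ∉ S ⊔ residueKer R n :=
  SetLike.not_le_iff_exists.1 h

/-- Two subspaces sharing a hyperplane that are distinct modulo the maximal ideal. -/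
theorem IsSubspace.inf_eq_and_sup {X Z P : Submodule R (Fin n → R)} (hX : IsSubspace (l + 1) X)
    (hZ : IsSubspace (l + 1) Z) (hP : IsSubspace l P) (hPX : P ≤ X) (hPZ : P ≤ Z)
    (h : ¬ Z ≤ X ⊔ residueKer R n) : X ⊓ Z = P ∧ IsSubspace (l + 2) (X ⊔ Z) := by
  obtain ⟨c, hcZ, hc⟩ := exists_not_mem_sup_residueKer h
  have hZe := hP.eq_sup_span hZ hPZ hcZ (not_mem_sup_residueKer_of_le hPX hc)
  constructor
  · refine le_antisymm ?_ (le_inf hPX hPZ)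
    rw [hZe, inf_comm]
    exact hX.inf_sup_span_le hPX hc
  · have : X ⊔ Z = X ⊔ R ∙ c := by rw [hZe, ← sup_assoc, sup_eq_left.2 hPX]
    rw [this]
    exact hX.sup_span hc

theorem IsSubspace.inf {X Z : Submodule R (Fin n → R)} (hX : IsSubspace (l + 1) X)
    (hZ : IsSubspace (l + 1) Z) (hs : ShareSubspace l X Z)
    (h : ¬ Z ≤ X ⊔ residueKer R n) : IsSubspace l (X ⊓ Z) := by
  obtain ⟨P, hP, hPX, hPZ⟩ := hs
  rwa [(hX.inf_eq_and_sup hZ hP hPX hPZ h).1]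

theorem IsSubspace.sup {X Z : Submodule R (Fin n → R)} (hX : IsSubspace (l + 1) X)
    (hZ : IsSubspace (l + 1) Z) (hs : ShareSubspace l X Z)
    (h : ¬ Z ≤ X ⊔ residueKer R n) : IsSubspace (l + 2) (X ⊔ Z) := by
  obtain ⟨P, hP, hPX, hPZ⟩ := hs
  exact (hX.inf_eq_and_sup hZ hP hPX hPZ h).2

/-- Three pairwise adjacent subspaces not in a common top, modulo the maximal ideal, lie in a
common star. -/
theorem IsSubspace.inf_le_of_not_le_sup {X Z T : Submodule R (Fin n → R)}
    (hX : IsSubspace (l + 1) X) (hZ : IsSubspace (l + 1) Z) (hT : IsSubspace (l + 1) T)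
    (hXZ : ShareSubspace l X Z) (hXT : ShareSubspace l X T) (hZT : ShareSubspace l Z T)
    (h : ¬ Z ≤ X ⊔ residueKer R n) (hTS : ¬ T ≤ X ⊔ Z ⊔ residueKer R n) : X ⊓ Z ≤ T := by
  have hS := hX.sup hZ hXZ h
  have hI := hX.inf hZ hXZ h
  obtain ⟨c, hcT, hc⟩ := exists_not_mem_sup_residueKer hTS
  obtain ⟨P, hP, hPX, hPT⟩ := hXT
  obtain ⟨Q, hQ, hQZ, hQT⟩ := hZT
  have hPS : P ≤ X ⊔ Z := hPX.trans le_sup_left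
  have hTP := hP.eq_sup_span hT hPT hcT (not_mem_sup_residueKer_of_le hPS hc)
  -- Since T meets X ⊔ Z only in P, the common subspace Q of Z and T lies in X too, and so equals X
  -- ⊓ Z.
  have h1 : T ⊓ (X ⊔ Z) ≤ P := by
    rw [hTP]
    exact hS.inf_sup_span_le hPS hc
  have h2 : Q ≤ P := (le_inf hQT (hQZ.trans le_sup_right)).trans h1
  rw [← hQ.eq_of_le hI (le_inf (h2.trans hPX) hQZ)]
  exact hQT

/-- Three pairwise adjacent subspaces not in a common star, modulo the maximal ideal, lie in a
common top. -/
theorem IsSubspace.le_sup_of_not_inf_le {X Z T : Submodule R (Fin n → R)}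
    (hX : IsSubspace (l + 1) X) (hZ : IsSubspace (l + 1) Z) (hT : IsSubspace (l + 1) T)
    (hXZ : ShareSubspace l X Z) (hXT : ShareSubspace l X T) (hZT : ShareSubspace l Z T)
    (h : ¬ Z ≤ X ⊔ residueKer R n) (hTP : ¬ X ⊓ Z ≤ T ⊔ residueKer R n) : T ≤ X ⊔ Z := by
  have hS := hX.sup hZ hXZ h
  obtain ⟨a, ⟨haX, haZ⟩, ha⟩ := exists_not_mem_sup_residueKer hTP
  have hTa := hT.sup_span ha
  -- T ⊔ Y and T ⊔ R ∙ a have the same dimension l + 2, so they coincide. With Y = X and Y = Z this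
  -- identifies X ⊔ Z.
  have key : ∀ Y, IsSubspace (l + 1) Y → ShareSubspace l Y T → a ∈ Y → Y ≤ T ⊔ R ∙ a := by
    intro Y hY hYT haY
    have h1 := hT.sup hY hYT.symm fun h => ha (h haY)
    have h2 := hTa.eq_of_le h1 (sup_le_sup_left (by simpa using haY) T)
    rw [h2]
    exact le_sup_right
  rw [hS.eq_of_le hTa (sup_le (key X hX hXT haX) (key Z hZ hZT haZ))]
  exact le_sup_left

/-- Two tops through `X` that differ modulo the maximal ideal meet in `X` only. -/
theorem IsSubspace.mem_sup_residueKer_of_mem_sups {X W S : Submodule R (Fin n → R)}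
    (hW : IsSubspace (l + 1) W) (hXW : ShareSubspace l X W) (hXS : X ≤ S)
    (hWS : ¬ W ≤ S ⊔ residueKer R n) {t : Fin n → R} (htS : t ∈ S ⊔ residueKer R n)
    (htW : t ∈ X ⊔ W ⊔ residueKer R n) : t ∈ X ⊔ residueKer R n := by
  obtain ⟨c, hcW, hc⟩ := exists_not_mem_sup_residueKer hWS
  obtain ⟨P, hP, hPX, hPW⟩ := hXW
  have hWe := hP.eq_sup_span hW hPW hcW (not_mem_sup_residueKer_of_le (hPX.trans hXS) hc)
  have hXWe : X ⊔ W ⊔ residueKer R n = X ⊔ residueKer R n ⊔ R ∙ c := by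
    rw [hWe, ← sup_assoc, sup_eq_left.2 hPX, sup_right_comm]
  rw [hXWe] at htW
  obtain ⟨y, hy, z, hz, rfl⟩ := Submodule.mem_sup.1 htW
  obtain ⟨γ, rfl⟩ := Submodule.mem_span_singleton.1 hz
  have hγc : γ • c ∈ S ⊔ residueKer R n := by
    have := sub_mem htS (sup_le_sup_right hXS (residueKer R n) hy)
    simpa using this
  refine add_mem hy (Submodule.mem_sup_right (smul_mem_residueKer ?_ c))
  rw [mem_maximalIdeal, mem_nonunits_iff]
  intro hu
  exact hc ((Submodule.smul_mem_iff_of_isUnit _ hu).1 hγc)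

/-- Two hyperplanes of `X` that differ modulo the maximal ideal span `X`. -/
theorem IsSubspace.le_sup_residueKer_of_hyperplanes {X P Q T : Submodule R (Fin n → R)}
    (hX : IsSubspace (l + 1) X) (hQ : IsSubspace l Q) (hQX : Q ≤ X) (hPX : P ≤ X)
    (hPQ : ¬ P ≤ Q ⊔ residueKer R n) (hQT : Q ≤ T ⊔ residueKer R n)
    (hPT : P ≤ T ⊔ residueKer R n) : X ≤ T ⊔ residueKer R n := by
  obtain ⟨a, haP, ha⟩ := exists_not_mem_sup_residueKer hPQ
  rw [hQ.eq_sup_span hX hQX (hPX haP) ha]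
  exact sup_le hQT (by simpa using hPT haP)

/-- The shape of a clique having two members that differ modulo the maximal ideal. -/
theorem clique_trichotomy {C : Set (Submodule R (Fin n → R))}
    (hC : ∀ X ∈ C, IsSubspace (l + 1) X) (hs : ∀ X ∈ C, ∀ Y ∈ C, ShareSubspace l X Y)
    {X Z : Submodule R (Fin n → R)} (hX : X ∈ C) (hZ : Z ∈ C) (h : ¬ Z ≤ X ⊔ residueKer R n) :
    (∀ W ∈ C, X ⊓ Z ≤ W) ∨ (∀ W ∈ C, W ≤ X ⊔ Z) ∨
      ∀ W ∈ C, W ≤ X ⊔ Z ⊔ residueKer R n ∧ X ⊓ Z ≤ W ⊔ residueKer R n := by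
  have star : ∀ {A B T}, A ∈ C → B ∈ C → T ∈ C → ¬ B ≤ A ⊔ residueKer R n →
      ¬ A ⊓ B ≤ T → T ≤ A ⊔ B ⊔ residueKer R n := fun hA hB hT hAB hn => by
    by_contra hc
    exact hn ((hC _ hA).inf_le_of_not_le_sup (hC _ hB) (hC _ hT) (hs _ hA _ hB) (hs _ hA _ hT)
      (hs _ hB _ hT) hAB hc)
  have top : ∀ {A B T}, A ∈ C → B ∈ C → T ∈ C → ¬ B ≤ A ⊔ residueKer R n →
      ¬ T ≤ A ⊔ B → A ⊓ B ≤ T ⊔ residueKer R n := fun hA hB hT hAB hn => by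
    by_contra hc
    exact hn ((hC _ hA).le_sup_of_not_inf_le (hC _ hB) (hC _ hT) (hs _ hA _ hB) (hs _ hA _ hT)
      (hs _ hB _ hT) hAB hc)
  have h' : ¬ X ≤ Z ⊔ residueKer R n := fun hc =>
    h ((hC _ hZ).le_sup_residueKer_symm (hC _ hX) hc)
  have hI := (hC _ hX).inf (hC _ hZ) (hs _ hX _ hZ) h
  have hS := (hC _ hX).sup (hC _ hZ) (hs _ hX _ hZ) h
  by_contra! hcon
  obtain ⟨⟨T, hT, hPT⟩, ⟨T', hT', hTS⟩, W, hW, hcon⟩ := hcon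
  refine hcon ?_ ?_
  · by_contra hWS
    have hPW : X ⊓ Z ≤ W := by
      by_contra hc
      exact hWS (star hX hZ hW h hc)
    -- Here Y ⊓ W = X ⊓ Z, so T lies modulo the maximal ideal in both tops X ⊔ Z and Y ⊔ W, which
    -- meet in Y. Taking Y = X and Y = Z makes X and Z agree, a contradiction.
    have key : ∀ Y ∈ C, X ⊓ Z ≤ Y → Y ≤ X ⊔ Z → T ≤ Y ⊔ residueKer R n := by
      intro Y hY hPY hYS
      have hWY : ¬ W ≤ Y ⊔ residueKer R n := fun hc => hWS (hc.trans (sup_le_sup_right hYS _))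
      have hYW := (hC _ hY).inf (hC _ hW) (hs _ hY _ hW) hWY
      have hTYW : T ≤ Y ⊔ W ⊔ residueKer R n := by
        refine star hY hW hT hWY ?_
        rwa [← hI.eq_of_le hYW (le_inf hPY hPW)]
      intro t ht
      exact (hC _ hW).mem_sup_residueKer_of_mem_sups (hs _ hY _ hW) hYS hWS
        (star hX hZ hT h hPT ht) (hTYW ht)
    have hTX := (hC _ hX).le_sup_residueKer_symm (hC _ hT) (key X hX inf_le_left le_sup_left)
    have hTZ := key Z hZ inf_le_right le_sup_right
    exact h' (hTX.trans (sup_le hTZ le_sup_right))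
  · by_contra hPW
    have hWS : W ≤ X ⊔ Z := by
      by_contra hc
      exact hPW (top hX hZ hW h hc)
    have hPT' := top hX hZ hT' h hTS
    -- The dual argument: Y ⊔ W = X ⊔ Z, so T' contains, modulo the maximal ideal, the two distinct
    -- hyperplanes Y ⊓ W and X ⊓ Z of Y.
    have key : ∀ Y ∈ C, X ⊓ Z ≤ Y → Y ≤ X ⊔ Z → Y ≤ T' ⊔ residueKer R n := by
      intro Y hY hPY hYS
      have hWY : ¬ W ≤ Y ⊔ residueKer R n := fun hc =>
        hPW (hPY.trans ((hC _ hY).le_sup_residueKer_symm (hC _ hW) hc))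
      have hYW := (hC _ hY).inf (hC _ hW) (hs _ hY _ hW) hWY
      have hYWS := (hC _ hY).sup (hC _ hW) (hs _ hY _ hW) hWY
      have hYWT : Y ⊓ W ≤ T' ⊔ residueKer R n := by
        refine top hY hW hT' hWY ?_
        rwa [hYWS.eq_of_le hS (sup_le hYS hWS)]
      exact (hC _ hY).le_sup_residueKer_of_hyperplanes hYW inf_le_left hPY
        (fun hc => hPW (hc.trans (sup_le_sup_right inf_le_right _))) hYWT hPT'
    have hT'X := (hC _ hT').le_sup_residueKer_symm (hC _ hX) (key X hX inf_le_left le_sup_left)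
    exact h ((key Z hZ inf_le_right le_sup_right).trans (sup_le hT'X le_sup_right))

end Configurations

/-! ### Complementary coordinates and nonsingular matrix spaces -/

section FiberBound

open IsLocalRing

variable {R : Type*} [CommRing R] [IsLocalRing R] {n k l m : ℕ}

/-- Coordinates on the kernel of a map dual to a unimodular family. -/
theorem exists_complementary_coordinates (β : (Fin n → R) →ₗ[R] (Fin m → R))
    {v : Fin m → Fin n → R} (hβ : ∀ i, β (v i) = Pi.single i 1) :
    ∃ ρ : (Fin n → R) →ₗ[R] (Fin (n - m) → R), (∀ i, ρ (v i) = 0) ∧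
      ∀ x, β x = 0 → ρ x = 0 → x = 0 := by
  set σ : (Fin m → R) →ₗ[R] (Fin n → R) := Fintype.linearCombination R v with hσ
  have hβσ : ∀ y, β (σ y) = y := by
    intro y
    rw [hσ, Fintype.linearCombination_apply, map_sum]
    simp only [map_smul, hβ]
    exact (pi_eq_sum_univ' y).symm
  let pr : (Fin n → R) →ₗ[R] LinearMap.ker β :=
    LinearMap.codRestrict _ (LinearMap.id - σ ∘ₗ β) fun x => by simp [hβσ]
  have hpr : ∀ x, (pr x : Fin n → R) = x - σ (β x) := fun x => rfl
  have hprE : ∀ x : LinearMap.ker β, pr x = x := by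
    intro x
    ext1
    rw [hpr, LinearMap.mem_ker.1 x.2, map_zero, sub_zero]
  let e : (Fin n → R) ≃ₗ[R] LinearMap.ker β × (Fin m → R) :=
    LinearEquiv.ofLinearMap (pr.prod β) (LinearMap.coprod (Submodule.subtype _) σ)
      (by
        apply LinearMap.ext
        rintro ⟨x, y⟩
        have h1 : pr (σ y) = 0 := by
          ext1
          rw [hpr, hβσ, sub_self]; rfl
        have h2 : β (x : Fin n → R) = 0 := x.2
        simp [hprE, h1, h2, hβσ])
      (by
        apply LinearMap.ext
        intro x
        simp [hpr])
  -- A direct summand of R^n is projective, hence free over a local ring; the splitting `e` gives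
  -- its rank.
  have hproj : Module.Projective R (LinearMap.ker β) :=
    Module.Projective.of_split (Submodule.subtype _) pr (LinearMap.ext hprE)
  have hfin : Module.Finite R (LinearMap.ker β) :=
    Module.Finite.of_surjective pr fun x => ⟨x, hprE x⟩
  have hfree : Module.Free R (LinearMap.ker β) := Module.free_of_flat_of_isLocalRing
  have hrank : Module.finrank R (LinearMap.ker β) = n - m := by
    have := e.finrank_eq
    rw [Module.finrank_prod, Module.finrank_fin_fun, Module.finrank_fin_fun] at this
    omega
  let b := Module.finBasisOfFinrankEq R (LinearMap.ker β) hrank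
  refine ⟨b.equivFun.toLinearMap ∘ₗ pr, fun i => ?_, fun x hx hρ => ?_⟩
  · have : pr (v i) = 0 := by
      ext1
      rw [hpr, hβ, hσ, Fintype.linearCombination_apply_single]
      simp
    simp [this]
  · have h1 : pr x = 0 := by
      apply b.equivFun.injective
      rw [map_zero]
      exact hρ
    have h2 := hpr x
    rw [h1, hx, map_zero, sub_zero] at h2
    exact h2.symm

/-- A linear space of `k × k` matrices of dimension `m` all of whose unimodular elements are
injective: the multiplications of the extension of degree `k` of the residue field, lifted. -/
theorem exists_nonsingular_matrix_space [Finite R] (hmk : m ≤ k) :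
    ∃ T : Fin m → Matrix (Fin k) (Fin k) R, ∀ u : Fin m → R, u ∉ residueKer R m →
      IsUnit (∑ i, u i • T i).det := by
  rcases Nat.eq_zero_or_pos k with rfl | hk
  · exact ⟨fun _ => 0, fun u _ => by simp⟩
  have : NeZero k := ⟨hk.ne'⟩
  obtain ⟨p, hp⟩ := CharP.exists (ResidueField R)
  have : Finite (ResidueField R) := Finite.of_surjective _ (residue_surjective (R := R))
  have : Fact p.Prime := ⟨CharP.char_is_prime (ResidueField R) p⟩
  let K := FiniteField.Extension (ResidueField R) p k
  let b : Module.Basis (Fin k) (ResidueField R) K :=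
    Module.finBasisOfFinrankEq _ _ (FiniteField.finrank_extension (ResidueField R) p k)
  have hlift : ∀ i : Fin m, ∃ T : Matrix (Fin k) (Fin k) R,
      T.map (residue R) = Algebra.leftMulMatrix b (b (Fin.castLE hmk i)) := by
    intro i
    have : ∀ x y, ∃ t : R, residue R t = Algebra.leftMulMatrix b (b (Fin.castLE hmk i)) x y :=
      fun x y => residue_surjective _
    choose t ht using this
    exact ⟨Matrix.of t, by ext x y; exact ht x y⟩
  choose T hT using hlift
  refine ⟨T, fun u hu => ?_⟩
  set g : K := ∑ i, residue R (u i) • b (Fin.castLE hmk i) with hg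
  have hg0 : g ≠ 0 := by
    intro h
    have hli : LinearIndependent (ResidueField R) fun i => b (Fin.castLE hmk i) :=
      b.linearIndependent.comp _ (Fin.castLE_injective hmk)
    have h1 := Fintype.linearIndependent_iff.1 hli _ h
    exact hu (mem_residueKer.2 fun i => (residue_eq_zero_iff _).1 (h1 i))
  have hmap : (∑ i, u i • T i).map (residue R) = Algebra.leftMulMatrix b g := by
    rw [hg, map_sum]
    simp only [map_smul, ← hT]
    ext x y
    simp [Matrix.sum_apply]
  rw [← residue_ne_zero_iff_isUnit, RingHom.map_det, RingHom.mapMatrix_apply, hmap]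
  have hunit : IsUnit (Algebra.leftMulMatrix b g) := (IsUnit.mk0 g hg0).map (Algebra.leftMulMatrix b)
  exact ((Matrix.isUnit_iff_isUnit_det _).1 hunit).ne_zero

end FiberBound

/-! ### Counting cliques with a single reduction -/

section FiberBoundCount

open IsLocalRing

variable {R : Type*} [CommRing R] [IsLocalRing R] {n k l m : ℕ}

/-- Two subspaces sharing a hyperplane, given by bases dual to the same `β`, agree as soon as the
images of their coordinates under a nonsingular matrix space do. -/
theorem IsSubspace.eq_of_sum_mulVec_eq {Y Y' : Submodule R (Fin n → R)}
    (hs : ShareSubspace l Y Y')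
    {β : (Fin n → R) →ₗ[R] (Fin (l + 1) → R)} {ρ : (Fin n → R) →ₗ[R] (Fin k → R)}
    (hβρ : ∀ x, β x = 0 → ρ x = 0 → x = 0)
    {T : Fin (l + 1) → Matrix (Fin k) (Fin k) R}
    (hT : ∀ u : Fin (l + 1) → R, u ∉ residueKer R (l + 1) → IsUnit (∑ i, u i • T i).det)
    {y y' : Fin (l + 1) → Fin n → R} (hy : Submodule.span R (Set.range y) = Y)
    (hy' : Submodule.span R (Set.range y') = Y') (hβy : ∀ i, β (y i) = Pi.single i 1)
    (hβy' : ∀ i, β (y' i) = Pi.single i 1)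
    (h : ∑ i, (T i).mulVec (ρ (y i)) = ∑ i, (T i).mulVec (ρ (y' i))) : Y = Y' := by
  obtain ⟨P, hP, hPY, hPY'⟩ := hs
  have hY : IsSubspace (l + 1) Y := hy ▸ (isUnimodular_iff_exists_dual.2 ⟨β, hβy⟩).isSubspace_span
  obtain ⟨a, haY, ha⟩ := exists_not_mem_sup_residueKer (hP.not_le_sup_residueKer hY)
  obtain ⟨φ, hφ, hφa⟩ := hP.exists_functional ha
  set σ' := Fintype.linearCombination R y' with hσ'
  have hσβ : ∀ x ∈ Y', σ' (β x) = x := by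
    intro x hx
    rw [← hy', Submodule.mem_span_range_iff_exists_fun] at hx
    obtain ⟨c, rfl⟩ := hx
    simp [hβy', hσ']
  have hYe := hP.eq_sup_span hY hPY haY ha
  set b := a - σ' (β a) with hb
  -- On Y = P ⊔ R ∙ a the map x ↦ x - σ' (β x) vanishes on P and sends `a` to `b`, so it is `φ`
  -- times `b`.
  have hdiff : ∀ i, y i - y' i = φ (y i) • b := by
    intro i
    have hyi : y i ∈ Y := hy ▸ Submodule.subset_span ⟨i, rfl⟩
    have hyi' : y' i = σ' (β (y i)) := by
      rw [hβy, hσ', Fintype.linearCombination_apply_single, one_smul]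
    rw [hYe] at hyi
    obtain ⟨p, hp, z, hz, e⟩ := Submodule.mem_sup.1 hyi
    obtain ⟨γ, rfl⟩ := Submodule.mem_span_singleton.1 hz
    rw [hyi', ← e]
    simp only [map_add, map_smul, hφ p hp, hφa, hσβ p (hPY' hp), hb, smul_sub, zero_add,
      smul_eq_mul, mul_one]
    abel
  -- Otherwise `φ` would map all of Y into the maximal ideal, but φ a = 1.
  have hu : (fun i => φ (y i)) ∉ residueKer R (l + 1) := by
    intro hu
    rw [← hy, Submodule.mem_span_range_iff_exists_fun] at haY
    obtain ⟨c, rfl⟩ := haY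
    rw [map_sum] at hφa
    have h1 : (1 : R) ∈ maximalIdeal R := by
      rw [← hφa]
      refine Ideal.sum_mem _ fun i _ => ?_
      rw [map_smul]
      exact Ideal.mul_mem_left _ _ (mem_residueKer.1 hu i)
    exact (Ideal.ne_top_iff_one _).1 (maximalIdeal.isMaximal R).ne_top h1
  have hw : (∑ i, φ (y i) • T i).mulVec (ρ b) = 0 := by
    rw [← sub_eq_zero, ← Finset.sum_sub_distrib] at h
    rw [← h, Matrix.sum_mulVec]
    refine Finset.sum_congr rfl fun i _ => ?_
    rw [← Matrix.mulVec_sub, ← map_sub, hdiff, map_smul, Matrix.mulVec_smul, Matrix.smul_mulVec]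
  have hw0 : ρ b = 0 := Matrix.mulVec_injective_of_isUnit
    ((Matrix.isUnit_iff_isUnit_det _).2 (hT _ hu)) (by rw [hw, Matrix.mulVec_zero])
  have hyy : y = y' := by
    funext i
    refine sub_eq_zero.1 (hβρ _ (by rw [map_sub, hβy, hβy', sub_self]) ?_)
    rw [hdiff, map_smul, hw0, smul_zero]
  rw [← hy, ← hy', hyy]

/-- A clique all of whose members agree modulo the maximal ideal is small. -/
theorem card_clique_le_of_le_sup_residueKer [Finite R] (hln : l + 1 ≤ n - (l + 1))
    {D : Finset (Submodule R (Fin n → R))} (hD : ∀ X ∈ D, IsSubspace (l + 1) X)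
    (hs : ∀ X ∈ D, ∀ Y ∈ D, ShareSubspace l X Y)
    (hr : ∀ X ∈ D, ∀ Y ∈ D, X ≤ Y ⊔ residueKer R n) :
    D.card ≤ Nat.card (maximalIdeal R) ^ (n - (l + 1)) := by
  rcases D.eq_empty_or_nonempty with rfl | ⟨X, hX⟩
  · simp
  obtain ⟨v, hv, -, hvX⟩ := hD X hX
  obtain ⟨β, hβ⟩ := isUnimodular_iff_exists_dual.1 hv
  obtain ⟨ρ, hρv, hβρ⟩ := exists_complementary_coordinates β hβ
  obtain ⟨T, hT⟩ := exists_nonsingular_matrix_space (R := R) hln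
  -- All members get bases dual to the same `β`; as they agree with X modulo the maximal ideal,
  -- their `ρ`-coordinates lie in that ideal.
  have hbasis : ∀ Y : D, ∃ y : Fin (l + 1) → Fin n → R, Submodule.span R (Set.range y) = Y.1 ∧
      (∀ i, β (y i) = Pi.single i 1) ∧ ∀ i, ρ (y i) ∈ residueKer R (n - (l + 1)) := by
    rintro ⟨Y, hY⟩
    have h1 : ∀ i, ∃ y ∈ Y, y - v i ∈ residueKer R n := by
      intro i
      have hvi : v i ∈ X := hvX ▸ Submodule.subset_span ⟨i, rfl⟩
      obtain ⟨y, hy, j, hj, e⟩ := Submodule.mem_sup.1 (hr X hX Y hY hvi)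
      exact ⟨y, hy, by rw [← e]; simpa using hj⟩
    choose y hyY hy using h1
    obtain ⟨z, hz, hβz, hzy⟩ := exists_normalized β (y := y) fun i => by
      rw [← hβ i, ← map_sub]
      exact map_mem_residueKer β (hy i)
    have hyY' : Submodule.span R (Set.range y) ≤ Y :=
      Submodule.span_le.2 (by rintro _ ⟨i, rfl⟩; exact hyY i)
    refine ⟨z, (hD Y hY).span_eq (isUnimodular_iff_exists_dual.2 ⟨β, hβz⟩) fun i => hyY' (hz i),
      hβz, fun i => ?_⟩
    have h2 : ρ (z i) = ρ (z i - y i) + ρ (y i - v i) := by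
      rw [← map_add, sub_add_sub_cancel, map_sub, hρv, sub_zero]
    rw [h2]
    exact add_mem (map_mem_residueKer ρ (hzy i)) (map_mem_residueKer ρ (hy i))
  choose y hyY hβy hρy using hbasis
  have hmem : ∀ Y : D, ∑ i, (T i).mulVec (ρ (y Y i)) ∈ residueKer R (n - (l + 1)) :=
    fun Y => Submodule.sum_mem _ fun i _ => map_mem_residueKer (T i).mulVecLin (hρy Y i)
  let f : D → (Fin (n - (l + 1)) → maximalIdeal R) :=
    fun Y j => ⟨(∑ i, (T i).mulVec (ρ (y Y i))) j, mem_residueKer.1 (hmem Y) j⟩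
  have hf : Function.Injective f := by
    intro Y Y' h
    ext1
    refine IsSubspace.eq_of_sum_mulVec_eq (hs _ Y.2 _ Y'.2) hβρ hT (hyY Y) (hyY Y') (hβy Y)
      (hβy Y') ?_
    funext j
    exact congrArg Subtype.val (congrFun h j)
  have h := Nat.card_le_card_of_injective f hf
  rwa [Nat.card_eq_fintype_card, Fintype.card_coe, Nat.card_fun, Nat.card_eq_fintype_card (α := Fin _),
    Fintype.card_fin] at h

end FiberBoundCount

/-! ### Adjacency and a large clique inside a star -/

section Graph

variable {R : Type*} [CommRing R] {n k l m : ℕ}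

theorem IsUnimodular.comp_injective {v : Fin k → Fin n → R} (hv : IsUnimodular v) {f : Fin l → Fin k}
    (hf : Function.Injective f) : IsUnimodular (v ∘ f) := by
  obtain ⟨β, hβ⟩ := isUnimodular_iff_exists_dual.1 hv
  refine isUnimodular_iff_exists_dual.2 ⟨LinearMap.funLeft R R f ∘ₗ β, fun i => ?_⟩
  ext j
  simp [LinearMap.funLeft_apply, hβ, Pi.single_apply, hf.eq_iff]

theorem IsSubspace.shareSubspace_self {X : Submodule R (Fin n → R)} (hX : IsSubspace (l + 1) X) :
    ShareSubspace l X X := by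
  obtain ⟨v, hv, -, rfl⟩ := hX
  have h := Submodule.span_mono (R := R) (Set.range_comp_subset_range Fin.succ v)
  exact ⟨_, (hv.comp_injective (Fin.succ_injective l)).isSubspace_span, h, h⟩

/-- If the intersection had dimension above l, then l + 1 unimodular vectors in it would span both X
and Y, forcing X = Y. -/
theorem grassmannGraph_adj_iff [Nontrivial R] {X Y : Vertex R n (l + 1)} :
    (grassmannGraph R n (l + 1)).Adj X Y ↔ X ≠ Y ∧ ShareSubspace l X.1 Y.1 := by
  refine and_congr_right fun hne => ⟨fun h => ?_, ?_⟩
  · have hmem := (dim_isGreatest (X.1 ⊓ Y.1)).1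
    rw [h] at hmem
    obtain ⟨v, hv, hu⟩ := hmem
    refine ⟨_, hu.isSubspace_span, ?_, ?_⟩ <;> refine Submodule.span_le.2 ?_ <;>
      rintro _ ⟨i, rfl⟩
    exacts [(hv i).1, (hv i).2]
  · rintro ⟨P, ⟨v, hv, -, rfl⟩, hPX, hPY⟩
    have hmem : ∀ i, v i ∈ X.1 ⊓ Y.1 := fun i =>
      ⟨hPX (Submodule.subset_span ⟨i, rfl⟩), hPY (Submodule.subset_span ⟨i, rfl⟩)⟩
    have hge : l ≤ dim (X.1 ⊓ Y.1) := (dim_isGreatest (X.1 ⊓ Y.1)).2 ⟨v, hmem, hv⟩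
    refine le_antisymm ?_ hge
    by_contra! hlt
    obtain ⟨w, hw, hu⟩ := (dim_isGreatest (X.1 ⊓ Y.1)).1
    have hle : l + 1 ≤ dim (X.1 ⊓ Y.1) := by omega
    have hu' := hu.comp_injective (Fin.castLE_injective hle)
    refine hne (Subtype.ext ?_)
    exact (X.2.span_eq hu' fun i => (hw _).1).symm.trans (Y.2.span_eq hu' fun i => (hw _).2)

theorem shareSubspace_of_isClique [Nontrivial R] {C : Set (Vertex R n (l + 1))}
    (hC : (grassmannGraph R n (l + 1)).IsClique C) {X Y : Vertex R n (l + 1)} (hX : X ∈ C)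
    (hY : Y ∈ C) : ShareSubspace l X.1 Y.1 := by
  by_cases h : X = Y
  · subst h
    exact X.2.shareSubspace_self
  · exact (grassmannGraph_adj_iff.1 (hC hX hY h)).2

theorem isClique_star [Nontrivial R] {P : Submodule R (Fin n → R)} (hP : IsSubspace l P) :
    (grassmannGraph R n (l + 1)).IsClique {X | P ≤ X.1} :=
  fun _ hX _ hY hne => grassmannGraph_adj_iff.2 ⟨hne, P, hP, hX, hY⟩

/-- There is a clique with `|R| ^ (n - (l + 1))` elements, inside a star. -/
theorem exists_clique_card_eq [Nontrivial R] [Finite R] (hln : l + 1 ≤ n) :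
    ∃ C : Finset (Vertex R n (l + 1)), (grassmannGraph R n (l + 1)).IsClique C ∧
      C.card = Nat.card R ^ (n - (l + 1)) := by
  classical
  have := Fintype.ofFinite R
  let β : (Fin n → R) →ₗ[R] (Fin (l + 1) → R) := LinearMap.funLeft R R (Fin.castLE hln)
  let e : (Fin (n - (l + 1)) → R) → Fin n → R :=
    fun w j => if h : l + 1 ≤ j then w ⟨j - (l + 1), by omega⟩ else 0
  have hβe : ∀ w, β (e w) = 0 := by
    intro w
    ext j
    simp [β, e, LinearMap.funLeft_apply]
    omega
  have he : Function.Injective e := by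
    intro w w' h
    ext j
    have := congrFun h ⟨j + (l + 1), by omega⟩
    simpa [e, show l < (j : ℕ) + (l + 1) by omega] using this
  let v : Fin (l + 1) → Fin n → R := fun i => Pi.single (Fin.castLE hln i) 1
  have hβv : ∀ i, β (v i) = Pi.single i 1 := by
    intro i
    ext j
    simp [β, v, LinearMap.funLeft_apply, Pi.single_apply]
  -- Only the first basis vector varies, by a vector in the kernel of `β`; the other l span the
  -- centre of the star.
  let y : (Fin (n - (l + 1)) → R) → Fin (l + 1) → Fin n → R :=
    fun w => Fin.cons (v 0 + e w) (v ∘ Fin.succ)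
  have hβy : ∀ w i, β (y w i) = Pi.single i 1 := by
    intro w i
    refine Fin.cases ?_ (fun i => ?_) i
    · simp [y, hβe, hβv]
    · simp [y, hβv]
  have hy : ∀ w, IsUnimodular (y w) := fun w => isUnimodular_iff_exists_dual.2 ⟨β, hβy w⟩
  let f : (Fin (n - (l + 1)) → R) → Vertex R n (l + 1) :=
    fun w => ⟨Submodule.span R (Set.range (y w)), (hy w).isSubspace_span⟩
  -- Injectivity of `β` on each member lets the member recover `y w 0`, hence `w`.
  have hker : ∀ w, ∀ x ∈ Submodule.span R (Set.range (y w)), β x = 0 → x = 0 := by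
    intro w x hx h
    obtain ⟨c, rfl⟩ := (Submodule.mem_span_range_iff_exists_fun R).1 hx
    simp only [map_sum, map_smul, hβy] at h
    rw [← pi_eq_sum_univ' c] at h
    simp [h]
  have hf : Function.Injective f := by
    intro w w' h
    have h1 : Submodule.span R (Set.range (y w)) = Submodule.span R (Set.range (y w')) :=
      congrArg Subtype.val h
    have hm : y w 0 ∈ Submodule.span R (Set.range (y w')) :=
      h1 ▸ Submodule.subset_span ⟨0, rfl⟩
    have h2 := hker w' _ (sub_mem hm (Submodule.subset_span ⟨0, rfl⟩)) (by simp [hβy])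
    apply he
    simpa [y, sub_eq_zero] using h2
  have hv : IsUnimodular v := isUnimodular_iff_exists_dual.2 ⟨β, hβv⟩
  have hP := (hv.comp_injective (Fin.succ_injective l)).isSubspace_span
  refine ⟨Finset.univ.image f, (isClique_star hP).subset ?_, ?_⟩
  · intro X hX
    obtain ⟨w, -, rfl⟩ := Finset.mem_image.1 (Finset.mem_coe.1 hX)
    refine Submodule.span_mono ?_
    rintro _ ⟨i, rfl⟩
    exact ⟨i.succ, by simp [y]⟩
  · rw [Finset.card_image_of_injective _ hf, Finset.card_univ, Fintype.card_fun, Fintype.card_fin,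
      Nat.card_eq_fintype_card]

end Graph

/-! ### Size bounds and the classification -/

section Counting

open IsLocalRing

variable {R : Type*} [CommRing R] [IsLocalRing R] {n k l m : ℕ}

theorem natCard_eq_residueField_mul_maximalIdeal :
    Nat.card R = Nat.card (ResidueField R) * Nat.card (maximalIdeal R) := by
  rw [Submodule.card_eq_card_quotient_mul_card (maximalIdeal R), mul_comm]
  rfl

/-- The members of a top are determined by nonzero functionals. -/
theorem card_top_lt [Finite R] {Q : Submodule R (Fin n → R)} (hQ : IsSubspace (l + 2) Q)
    {D : Finset (Submodule R (Fin n → R))} (hD : ∀ X ∈ D, IsSubspace (l + 1) X)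
    (hDQ : ∀ X ∈ D, X ≤ Q) : D.card < Nat.card R ^ (l + 2) := by
  classical
  have := Fintype.ofFinite R
  obtain ⟨q, hq, hqi, hqQ⟩ := hQ
  -- Each member is the kernel in Q of a functional taking the value 1 on Q; `f` lists its values on
  -- the basis `q`.
  have hf : ∀ X : Submodule R (Fin n → R), ∃ f : Fin (l + 2) → R, X ∈ D → f ≠ 0 ∧
      ∀ a : Fin (l + 2) → R, ∑ i, a i • q i ∈ X ↔ ∑ i, a i * f i = 0 := by
    intro X
    by_cases hX : X ∈ D
    swap
    · exact ⟨0, fun h => (hX h).elim⟩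
    have hQ' : IsSubspace (l + 2) Q := ⟨q, hq, hqi, hqQ⟩
    obtain ⟨c, hcQ, hc⟩ := exists_not_mem_sup_residueKer ((hD X hX).not_le_sup_residueKer hQ')
    obtain ⟨φ, hφ, hφc⟩ := (hD X hX).exists_functional hc
    have hQe := (hD X hX).eq_sup_span hQ' (hDQ X hX) hcQ hc
    have hker : ∀ x ∈ Q, φ x = 0 → x ∈ X := by
      intro x hx h
      rw [hQe] at hx
      obtain ⟨y, hy, z, hz, rfl⟩ := Submodule.mem_sup.1 hx
      obtain ⟨γ, rfl⟩ := Submodule.mem_span_singleton.1 hz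
      have : γ = 0 := by simpa [hφ y hy, hφc] using h
      simpa [this] using hy
    have hsum : ∀ a : Fin (l + 2) → R, φ (∑ i, a i • q i) = ∑ i, a i * φ (q i) := by
      intro a
      simp
    have hmem : ∀ a : Fin (l + 2) → R, ∑ i, a i • q i ∈ Q := fun a => by
      rw [← hqQ]
      exact (Submodule.mem_span_range_iff_exists_fun R).2 ⟨a, rfl⟩
    refine ⟨fun i => φ (q i), fun _ => ⟨fun h0 => ?_, fun a => ?_⟩⟩
    · rw [← hqQ, Submodule.mem_span_range_iff_exists_fun] at hcQ
      obtain ⟨a, rfl⟩ := hcQ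
      rw [hsum] at hφc
      simp [funext_iff] at h0
      simp [h0] at hφc
    · rw [← hsum]
      exact ⟨hφ _, hker _ (hmem a)⟩
  choose f hf using hf
  have hinj : Set.InjOn f D := by
    intro X hX Y hY h
    have key : ∀ X ∈ D, ∀ Y ∈ D, f X = f Y → X ≤ Y := by
      intro X hX Y hY h x hx
      have hxQ := hDQ X hX hx
      rw [← hqQ, Submodule.mem_span_range_iff_exists_fun] at hxQ
      obtain ⟨a, rfl⟩ := hxQ
      rw [(hf Y hY).2, ← h, ← (hf X hX).2]
      exact hx
    exact le_antisymm (key X hX Y hY h) (key Y hY X hX h.symm)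
  have h1 : D.card ≤ (Finset.univ.erase (0 : Fin (l + 2) → R)).card :=
    Finset.card_le_card_of_injOn f
      (fun X hX => Finset.mem_coe.2 (Finset.mem_erase.2 ⟨(hf X hX).1, Finset.mem_univ _⟩)) hinj
  have h2 : (Finset.univ.erase (0 : Fin (l + 2) → R)).card < (Finset.univ : Finset (Fin (l + 2) → R)).card :=
    Finset.card_erase_lt_of_mem (Finset.mem_univ _)
  rw [Finset.card_univ, Fintype.card_fun, Fintype.card_fin, ← Nat.card_eq_fintype_card] at h2
  omega

/-- A clique that lies, modulo the maximal ideal, in the intersection of a star and a top. -/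
theorem card_clique_lt_of_line [Finite R] (hl : 1 ≤ l) (hln : l + 1 ≤ n - (l + 1))
    {D : Finset (Submodule R (Fin n → R))} (hD : ∀ X ∈ D, IsSubspace (l + 1) X)
    (hs : ∀ X ∈ D, ∀ Y ∈ D, ShareSubspace l X Y) {P : Submodule R (Fin n → R)}
    (hP : IsSubspace l P) {a b : Fin n → R}
    (hDS : ∀ W ∈ D, W ≤ R ∙ a ⊔ R ∙ b ⊔ (P ⊔ residueKer R n))
    (hDP : ∀ W ∈ D, P ≤ W ⊔ residueKer R n) : D.card < Nat.card R ^ (n - (l + 1)) := by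
  classical
  have : Finite (ResidueField R) := Finite.of_surjective _ (residue_surjective (R := R))
  have := Fintype.ofFinite (ResidueField R)
  have hf : ∀ W, ∃ c : R × R, W ∈ D → ∃ w ∈ W, w ∉ P ⊔ residueKer R n ∧
      w - (c.1 • a + c.2 • b) ∈ P ⊔ residueKer R n := by
    intro W
    by_cases hW : W ∈ D
    swap
    · exact ⟨0, fun h => (hW h).elim⟩
    obtain ⟨w, hwW, hw⟩ := exists_not_mem_sup_residueKer (hP.not_le_sup_residueKer (hD W hW))
    obtain ⟨x, hx, y, hy, e⟩ := Submodule.mem_sup.1 (hDS W hW hwW)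
    obtain ⟨x1, hx1, x2, hx2, rfl⟩ := Submodule.mem_sup.1 hx
    obtain ⟨α, rfl⟩ := Submodule.mem_span_singleton.1 hx1
    obtain ⟨γ, rfl⟩ := Submodule.mem_span_singleton.1 hx2
    exact ⟨(α, γ), fun _ => ⟨w, hwW, hw, by rw [← e]; simpa using hy⟩⟩
  choose c hc using hf
  have hsmall : ∀ {α γ : R}, α ∈ maximalIdeal R → γ ∈ maximalIdeal R →
      α • a + γ • b ∈ P ⊔ residueKer R n := fun hα hγ =>
    Submodule.mem_sup_right (add_mem (smul_mem_residueKer hα a) (smul_mem_residueKer hγ b))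
  -- The residues of the `a`- and `b`-coordinates of a vector of W new modulo P: never both zero,
  -- and with P they determine W modulo the maximal ideal.
  let f : Submodule R (Fin n → R) → ResidueField R × ResidueField R :=
    fun W => (residue R (c W).1, residue R (c W).2)
  have hmaps : ∀ W ∈ D, f W ∈ Finset.univ.erase (0 : ResidueField R × ResidueField R) := by
    intro W hW
    refine Finset.mem_erase.2 ⟨fun h0 => ?_, Finset.mem_univ _⟩
    obtain ⟨w, hwW, hw, hwc⟩ := hc W hW
    rw [Prod.ext_iff] at h0
    have := hsmall ((residue_eq_zero_iff _).1 h0.1) ((residue_eq_zero_iff _).1 h0.2)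
    exact hw (by simpa using add_mem hwc this)
  have hfib : ∀ z ∈ Finset.univ.erase (0 : ResidueField R × ResidueField R),
      (D.filter fun W => f W = z).card ≤ Nat.card (maximalIdeal R) ^ (n - (l + 1)) := by
    intro z _
    refine card_clique_le_of_le_sup_residueKer hln (fun X hX => hD X (Finset.mem_filter.1 hX).1)
      (fun X hX Y hY => hs X (Finset.mem_filter.1 hX).1 Y (Finset.mem_filter.1 hY).1) ?_
    intro X hX Y hY
    obtain ⟨hX, hXz⟩ := Finset.mem_filter.1 hX
    obtain ⟨hY, hYz⟩ := Finset.mem_filter.1 hY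
    have hXY := Prod.ext_iff.1 (hXz.trans hYz.symm)
    obtain ⟨x, hxX, hx, hxc⟩ := hc X hX
    obtain ⟨y, hyY, hy, hyc⟩ := hc Y hY
    obtain ⟨P', hP', hP'X, hP'P, -⟩ := hP.exists_lift (hDP X hX)
    have hx' : x ∉ P' ⊔ residueKer R n := fun h => hx (sup_le hP'P le_sup_right h)
    have hPY : P ⊔ residueKer R n ≤ Y ⊔ residueKer R n := sup_le (hDP Y hY) le_sup_right
    rw [hP'.eq_sup_span (hD X hX) hP'X hxX hx']
    refine sup_le (hP'P.trans hPY) ?_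
    rw [Submodule.span_singleton_le_iff_mem]
    have h1 : ((c X).1 - (c Y).1) • a + ((c X).2 - (c Y).2) • b ∈ P ⊔ residueKer R n :=
      hsmall ((residue_eq_zero_iff _).1 (by rw [map_sub, sub_eq_zero]; exact hXY.1))
        ((residue_eq_zero_iff _).1 (by rw [map_sub, sub_eq_zero]; exact hXY.2))
    have h2 : x = (x - ((c X).1 • a + (c X).2 • b) - (y - ((c Y).1 • a + (c Y).2 • b)) +
        (((c X).1 - (c Y).1) • a + ((c X).2 - (c Y).2) • b)) + y := by
      simp only [sub_smul]
      abel
    rw [h2]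
    exact add_mem (hPY (add_mem (sub_mem hxc hyc) h1)) (Submodule.mem_sup_left hyY)
  have hcard := Finset.card_le_mul_card_image_of_maps_to hmaps _ hfib
  rw [Finset.card_erase_of_mem (Finset.mem_univ _), Finset.card_univ, Fintype.card_prod,
    ← Nat.card_eq_fintype_card] at hcard
  have hq : 0 < Nat.card (ResidueField R) := Nat.card_pos
  have hI : 0 < Nat.card (maximalIdeal R) := Nat.card_pos
  -- The exponent is at least l + 1 ≥ 2.
  have hpow : Nat.card (ResidueField R) * Nat.card (ResidueField R) ≤
      Nat.card (ResidueField R) ^ (n - (l + 1)) := by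
    rw [← sq]
    exact Nat.pow_le_pow_right hq (by omega)
  rw [natCard_eq_residueField_mul_maximalIdeal, mul_pow, mul_comm]
  refine hcard.trans_lt (Nat.mul_lt_mul_of_pos_left ?_ (pow_pos hI _))
  have : 0 < Nat.card (ResidueField R) * Nat.card (ResidueField R) := Nat.mul_pos hq hq
  omega

/-- Over a ring with totally ordered divisibility, any two members of a top are adjacent. -/
theorem IsSubspace.shareSubspace_of_le (hdvd : ∀ a b : R, a ∣ b ∨ b ∣ a)
    {X Y Q : Submodule R (Fin n → R)} (hQ : IsSubspace (l + 2) Q) (hX : IsSubspace (l + 1) X)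
    (hY : IsSubspace (l + 1) Y) (hXQ : X ≤ Q) (hYQ : Y ≤ Q) : ShareSubspace l X Y := by
  obtain ⟨c, hcQ, hc⟩ := exists_not_mem_sup_residueKer (hX.not_le_sup_residueKer hQ)
  have hQe := hX.eq_sup_span hQ hXQ hcQ hc
  obtain ⟨y, hy, -, rfl⟩ := hY
  obtain ⟨β, hβ⟩ := isUnimodular_iff_exists_dual.1 hy
  have hy' : ∀ i, ∃ γ : R, y i - γ • c ∈ X := by
    intro i
    have h := hYQ (Submodule.subset_span ⟨i, rfl⟩)
    rw [hQe] at h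
    obtain ⟨x, hx, z, hz, e⟩ := Submodule.mem_sup.1 h
    obtain ⟨γ, rfl⟩ := Submodule.mem_span_singleton.1 hz
    exact ⟨γ, by rw [← e]; simpa using hx⟩
  choose γ hγ using hy'
  have hdir : Directed (fun a b : R => b ∣ a) γ := fun i j => by
    rcases hdvd (γ i) (γ j) with h | h
    exacts [⟨i, dvd_rfl, h⟩, ⟨j, h, dvd_rfl⟩]
  have : IsTrans R fun a b => b ∣ a := ⟨fun _ _ _ h1 h2 => h2.trans h1⟩
  -- With this pivot, subtracting multiples of `y i₀` clears the `c`-component of the other l basis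
  -- vectors of Y, which puts them in X.
  obtain ⟨i₀, hi₀⟩ : ∃ i₀, ∀ i, γ i₀ ∣ γ i := hdir.finite_le id
  choose δ hδ using hi₀
  have hz : IsUnimodular fun j : Fin l => y (i₀.succAbove j) - δ (i₀.succAbove j) • y i₀ := by
    refine isUnimodular_iff_exists_dual.2
      ⟨LinearMap.funLeft R R i₀.succAbove ∘ₗ β, fun i => ?_⟩
    ext j
    simp [LinearMap.funLeft_apply, hβ, Pi.single_apply, Fin.succAbove_ne]
  refine ⟨_, hz.isSubspace_span, ?_, ?_⟩ <;> refine Submodule.span_le.2 ?_ <;> rintro _ ⟨j, rfl⟩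
  · have h := sub_mem (hγ (i₀.succAbove j)) (X.smul_mem (δ (i₀.succAbove j)) (hγ i₀))
    have e : y (i₀.succAbove j) - γ (i₀.succAbove j) • c -
        δ (i₀.succAbove j) • (y i₀ - γ i₀ • c) =
        y (i₀.succAbove j) - δ (i₀.succAbove j) • y i₀ := by
      rw [hδ (i₀.succAbove j), smul_sub, smul_smul, mul_comm (γ i₀)]
      abel
    rwa [e] at h
  · exact sub_mem (Submodule.subset_span ⟨_, rfl⟩)
      (Submodule.smul_mem _ _ (Submodule.subset_span ⟨_, rfl⟩))

theorem isClique_top (hdvd : ∀ a b : R, a ∣ b ∨ b ∣ a) {Q : Submodule R (Fin n → R)}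
    (hQ : IsSubspace (l + 2) Q) : (grassmannGraph R n (l + 1)).IsClique {X | X.1 ≤ Q} :=
  fun X hX Y hY hne =>
    grassmannGraph_adj_iff.2 ⟨hne, hQ.shareSubspace_of_le hdvd X.2 Y.2 hX hY⟩

/-- A clique of largest size fills any clique containing it. -/
theorem eq_of_subset_of_isMaximumClique {V : Type*} [Finite V] {G : SimpleGraph V} {M : Finset V}
    (hM : G.IsMaximumClique M) {C : Set V} (hC : G.IsClique C) (hMC : ↑M ⊆ C) : ↑M = C := by
  classical
  have := Fintype.ofFinite V
  have h := Finset.eq_of_subset_of_card_le (Set.subset_toFinset.2 hMC)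
    (hM.maximum C.toFinset (by simpa using hC))
  rw [h, Set.coe_toFinset]

/-- Maximum cliques over a finite local ring with totally ordered divisibility. -/
theorem isStar_or_isTop_of_isMaximumClique [Finite R] (hdvd : ∀ a b : R, a ∣ b ∨ b ∣ a)
    (hln : 2 * (l + 1) ≤ n) {M : Finset (Vertex R n (l + 1))}
    (hM : (grassmannGraph R n (l + 1)).IsMaximumClique M) :
    IsStar (M : Set (Vertex R n (l + 1))) ∨
      (n = 2 * (l + 1) ∧ IsTop (M : Set (Vertex R n (l + 1)))) := by
  classical
  have hstar : ∀ P, IsSubspace l P → (∀ X ∈ M, P ≤ X.1) →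
      IsStar (M : Set (Vertex R n (l + 1))) := fun P hP h =>
    ⟨P, hP, eq_of_subset_of_isMaximumClique hM (isClique_star hP) h⟩
  rcases Nat.eq_zero_or_pos l with rfl | hl
  -- For m = 1 the centre is the zero subspace.
  · exact Or.inl (hstar ⊥ isSubspace_zero_bot fun _ _ => bot_le)
  obtain ⟨C, hC, hCcard⟩ := exists_clique_card_eq (R := R) (n := n) (l := l) (by omega)
  have hcard : Nat.card R ^ (n - (l + 1)) ≤ M.card := hCcard ▸ hM.maximum C hC
  set D : Finset (Submodule R (Fin n → R)) := M.map (Function.Embedding.subtype _) with hDdef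
  have hDM : D.card = M.card := Finset.card_map _
  have hmemD : ∀ {X : Vertex R n (l + 1)}, X ∈ M → X.1 ∈ D := fun h =>
    Finset.mem_map_of_mem (Function.Embedding.subtype _) h
  have hD : ∀ X ∈ D, IsSubspace (l + 1) X := by
    intro X hX
    obtain ⟨Y, -, rfl⟩ := Finset.mem_map.1 hX
    exact Y.2
  have hs : ∀ X ∈ D, ∀ Y ∈ D, ShareSubspace l X Y := by
    intro X hX Y hY
    obtain ⟨X', hX', rfl⟩ := Finset.mem_map.1 hX
    obtain ⟨Y', hY', rfl⟩ := Finset.mem_map.1 hY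
    exact shareSubspace_of_isClique hM.isClique hX' hY'
  have hR : 1 < Nat.card (ResidueField R) := by
    have : Finite (ResidueField R) := Finite.of_surjective _ (residue_surjective (R := R))
    exact Finite.one_lt_card
  by_cases hred : ∀ X ∈ D, ∀ Y ∈ D, X ≤ Y ⊔ residueKer R n
  · have h1 := card_clique_le_of_le_sup_residueKer (by omega) hD hs hred
    have h2 : Nat.card (maximalIdeal R) < Nat.card R := by
      rw [natCard_eq_residueField_mul_maximalIdeal (R := R)]
      exact lt_mul_left Nat.card_pos hR
    have h3 := Nat.pow_lt_pow_left h2 (show n - (l + 1) ≠ 0 by omega)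
    omega
  push Not at hred
  obtain ⟨Z, hZ, X, hX, h⟩ := hred
  have hI := (hD X hX).inf (hD Z hZ) (hs X hX Z hZ) h
  have hS := (hD X hX).sup (hD Z hZ) (hs X hX Z hZ) h
  rcases clique_trichotomy (C := ↑D) hD hs hX hZ h with hc | hc | hc
  · exact Or.inl (hstar _ hI fun W hW => hc _ (hmemD hW))
  · have hlt := card_top_lt hS hD hc
    rcases hln.eq_or_lt with e | e
    · exact Or.inr ⟨e.symm, _, hS, eq_of_subset_of_isMaximumClique hM (isClique_top hdvd hS)
        fun W hW => hc _ (hmemD hW)⟩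
    · have : Nat.card R ^ (l + 2) ≤ Nat.card R ^ (n - (l + 1)) :=
        Nat.pow_le_pow_right Nat.card_pos (by omega)
      omega
  · have h' : ¬ X ≤ Z ⊔ residueKer R n := fun hc =>
      h ((hD Z hZ).le_sup_residueKer_symm (hD X hX) hc)
    obtain ⟨a, haX, ha⟩ := exists_not_mem_sup_residueKer h'
    obtain ⟨b, hbZ, hb⟩ := exists_not_mem_sup_residueKer h
    have hXe := hI.eq_sup_span (hD X hX) inf_le_left haX
      (not_mem_sup_residueKer_of_le inf_le_right ha)
    have hZe := hI.eq_sup_span (hD Z hZ) inf_le_right hbZ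
      (not_mem_sup_residueKer_of_le inf_le_left hb)
    have hle : X ⊔ Z ⊔ residueKer R n ≤ R ∙ a ⊔ R ∙ b ⊔ (X ⊓ Z ⊔ residueKer R n) := by
      refine sup_le (sup_le ?_ ?_) (le_sup_right.trans le_sup_right)
      · conv_lhs => rw [hXe]
        exact sup_le (le_sup_left.trans le_sup_right) (le_sup_left.trans le_sup_left)
      · conv_lhs => rw [hZe]
        exact sup_le (le_sup_left.trans le_sup_right) (le_sup_right.trans le_sup_left)
    have := card_clique_lt_of_line hl (by omega) hD hs hI
      (fun W hW => (hc W hW).1.trans hle) fun W hW => (hc W hW).2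
    omega

end Counting

/-! ### The ring ℤ/p^s -/

section ZModPrimePow

variable {p s : ℕ} [Fact p.Prime]

/-- Every residue modulo `p ^ s` is a unit times a power of `p`. -/
theorem zmod_prime_pow_eq_unit_mul_pow (x : ZMod (p ^ s)) :
    ∃ (e : ℕ) (u : (ZMod (p ^ s))ˣ), x = u * (p : ZMod (p ^ s)) ^ e := by
  have hp : p.Prime := Fact.out
  have : NeZero (p ^ s) := ⟨(pow_pos hp.pos s).ne'⟩
  obtain ⟨a, rfl⟩ := ZMod.natCast_zmod_surjective x
  rcases Nat.eq_zero_or_pos a with rfl | ha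
  · refine ⟨s, 1, ?_⟩
    rw [← Nat.cast_pow, ZMod.natCast_self]
    simp
  obtain ⟨e, b, hb, rfl⟩ := Nat.exists_eq_pow_mul_and_not_dvd ha.ne' p hp.ne_one
  have hcop : b.Coprime (p ^ s) := ((hp.coprime_iff_not_dvd.2 hb).symm).pow_right s
  exact ⟨e, ZMod.unitOfCoprime b hcop, by simp [mul_comm]⟩

theorem zmod_prime_pow_dvd_total (x y : ZMod (p ^ s)) : x ∣ y ∨ y ∣ x := by
  obtain ⟨e, u, rfl⟩ := zmod_prime_pow_eq_unit_mul_pow x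
  obtain ⟨f, w, rfl⟩ := zmod_prime_pow_eq_unit_mul_pow y
  simp only [Units.mul_left_dvd, Units.dvd_mul_left]
  exact (le_total e f).imp (pow_dvd_pow _) (pow_dvd_pow _)

/-- A nonunit x is a multiple of the nilpotent p, so 1 - x is a unit. -/
theorem zmod_prime_pow_isLocalRing (hs : 1 ≤ s) : IsLocalRing (ZMod (p ^ s)) := by
  have hp : p.Prime := Fact.out
  have : Fact (1 < p ^ s) := ⟨Nat.one_lt_pow (by omega) hp.one_lt⟩
  have hunit : ∀ x : ZMod (p ^ s), IsUnit x ∨ (p : ZMod (p ^ s)) ∣ x := by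
    intro x
    obtain ⟨e, u, rfl⟩ := zmod_prime_pow_eq_unit_mul_pow x
    rcases e with _ | e
    · exact Or.inl (by simp)
    · exact Or.inr (Dvd.dvd.mul_left (dvd_pow_self _ e.succ_ne_zero) _)
  have hnil : IsNilpotent (p : ZMod (p ^ s)) := ⟨s, by rw [← Nat.cast_pow, ZMod.natCast_self]⟩
  refine IsLocalRing.of_isUnit_or_isUnit_one_sub_self fun x => ?_
  rcases hunit x with h | ⟨y, rfl⟩
  · exact Or.inl h
  · exact Or.inr ((Commute.all _ y).isNilpotent_mul_right hnil).isUnit_one_sub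

end ZModPrimePow

end ResidueGrassmann

theorem theorem4p6 (p s n m : ℕ) [Fact p.Prime] (hs : 1 ≤ s) (hm : 1 ≤ m)
    (M : Finset (ResidueGrassmann.Vertex (ZMod (p ^ s)) n m))
    (hM : (ResidueGrassmann.grassmannGraph (ZMod (p ^ s)) n m).IsMaximumClique M) :
    (2 * m < n → ResidueGrassmann.IsStar (M : Set (ResidueGrassmann.Vertex (ZMod (p ^ s)) n m))) ∧
    (n = 2 * m →
      ResidueGrassmann.IsStar (M : Set (ResidueGrassmann.Vertex (ZMod (p ^ s)) n m)) ∨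
      ResidueGrassmann.IsTop (M : Set (ResidueGrassmann.Vertex (ZMod (p ^ s)) n m))) := by
  obtain ⟨l, rfl⟩ := Nat.exists_eq_add_of_le' hm
  have := ResidueGrassmann.zmod_prime_pow_isLocalRing (p := p) hs
  have key := fun h => ResidueGrassmann.isStar_or_isTop_of_isMaximumClique
    ResidueGrassmann.zmod_prime_pow_dvd_total h hM
  refine ⟨fun h => (key h.le).resolve_right fun h' => by omega, fun h => ?_⟩
  exact (key h.ge).imp_right And.right
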